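/- Let $n\in\mathbb N$ and let all processes be defined on one probability space. An \emph{additive process} is a process with càdlàg paths that starts at $0$ almost surely and has independent (not necessarily stationary) increments; a \emph{Lévy process} started at $0$ is an additive process with stationary increments. A \emph{Lévy measure} on $\mathbb R^n\setminus\{0\}$ is a Borel measure $\mu$ with $\int(|x|^2\wedge 1)\,\mu(dx)<\infty$. For $c\in\mathbb R^n$, a symmetric nonnegative definite matrix $Q\in\mathbb R^{n\times n}$ and a Lévy measure $\mu$ put $$\Psi_{(c,Q,\mu)}(u)=i\,u\cdot c-\tfrac12\,u\cdot Qu+\int_{\mathbb R^n\setminus\{0\}}\big[e^{iu\cdot x}-1-i(u\cdot x)\mathbf 1_{\{|x|\le 1\}}\big]\mu(dx),\qquad u\in\mathbb R^n.$$ Let $X=(X_t)_{t\ge0}$ be an $\mathbb R^n$-valued Lévy process started at $0$ with characteristic triplet $(c,Q,\nu)$, i.e. $\mathbf E[e^{iu\cdot X_t}]=e^{t\Psi_{(c,Q,\nu)}(u)}$ for all $t\ge0$, $u\in\mathbb R^n$. Let $\beta:[0,\infty)\to[0,\infty)$ and $g:[0,\infty)\times(0,\infty)\to[0,\infty)$ be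 continuous with $\int_{(0,\infty)}(1\wedge r)g(s,r)\,dr<\infty$ for every $s\ge0$, and let $Z=(Z_t)_{t\ge0}$ be an additive process with values in $[0,\infty)$ and nondecreasing paths, independent of $X$, such that for all $t\ge0$ and all $u\in\mathbb C$ with $\Re u\ge0$ $$\mathbf E[e^{-uZ_t}]=\exp\Big(\int_0^t\psi_s(u)\,ds\Big),\qquad \psi_s(u)=-u\beta(s)+\int_{(0,\infty)}(e^{-ur}-1)g(s,r)\,dr,$$ where $s\mapsto\psi_s(u)$ is integrable on $[0,t]$. Then the process $Y_t=X_{Z_t}$, $t\ge0$, is an additive process with càdlàg paths (and is continuous in probability). For $s\ge0$ define, on the Borel sets of $\mathbb R^n\setminus\{0\}$, $$\widetilde\nu_s(dx)=\beta(s)\,\nu(dx)+\int_{(0,\infty)}\mathbf P(X_r\in dx)\,g(s,r)\,dr,$$ and $$\widetilde Q_s=\beta(s)Q,\qquad \widetilde c_s=\beta(s)c+\int_{(0,\infty)}\mathbf E\big[X_r\mathbf 1_{\{|X_r|\le1\}}\big]g(s,r)\,dr .$$ Then for every $s\ge 0$ the integral defining $\widetilde c_s$ converges absolutely, $\widetilde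 Q_s$ is symmetric and nonnegative definite, $\widetilde\nu_s$ is a Lévy measure, and, with $\Psi_s=\Psi_{(\widetilde c_s,\widetilde Q_s,\widetilde\nu_s)}$ (the integral over $x$ in it converging absolutely), for all $u\in\mathbb R^n$ and $t\ge0$ the function $s\mapsto\Psi_s(u)$ is integrable on $[0,t]$ and $$\mathbf E[e^{iu\cdot Y_t}]=\exp\Big(\int_0^t\Psi_s(u)\,ds\Big).$$ -/

import Mathlib

open MeasureTheory ProbabilityTheory Filter Topology Set
open scoped NNReal ENNReal Matrix

namespace AdditiveTimeChange

noncomputable section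

/-- A path is càdlàg: right-continuous with left limits (no condition from the left at `0`, where
`𝓝[<] 0 = ⊥`). -/
def IsCadlag {E : Type*} [TopologicalSpace E] (f : ℝ≥0 → E) : Prop :=
  ∀ t, ContinuousWithinAt f (Ici t) t ∧ ∃ l, Tendsto f (𝓝[<] t) (𝓝 l)

/-- An additive process with càdlàg paths: it starts at `0` almost surely, it has (jointly)
independent, possibly nonstationary, increments, and every path is càdlàg. -/
structure IsAdditive {Ω E : Type*} [MeasurableSpace Ω] [NormedAddCommGroup E] [MeasurableSpace E]
    (P : Measure Ω) (Y : ℝ≥0 → Ω → E) : Prop where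
  measurable : ∀ t, Measurable (Y t)
  zero : ∀ᵐ ω ∂P, Y 0 ω = 0
  indepIncrements : HasIndepIncrements Y P
  cadlag : ∀ ω, IsCadlag fun t ↦ Y t ω

/-- A Lévy process started at `0`: an additive process with stationary increments. -/
structure IsLevy {Ω E : Type*} [MeasurableSpace Ω] [NormedAddCommGroup E] [MeasurableSpace E]
    (P : Measure Ω) (X : ℝ≥0 → Ω → E) : Prop extends IsAdditive P X where
  stationary : ∀ s h, P.map (fun ω ↦ X (s + h) ω - X s ω) = P.map (X h)

/-- A Lévy measure on `ℝⁿ ∖ {0}`, viewed as a measure on `ℝⁿ` without mass at `0`. -/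
def IsLevyMeasure {n : ℕ} (ν : Measure (EuclideanSpace ℝ (Fin n))) : Prop :=
  ν {0} = 0 ∧ ∫⁻ x, ENNReal.ofReal (min (‖x‖ ^ 2) 1) ∂ν < ∞

/-- The function `x ↦ e^{i u·x} - 1 - i (u·x) 1_{|x| ≤ 1}`. -/
def levyIntegrand {n : ℕ} (u x : EuclideanSpace ℝ (Fin n)) : ℂ :=
  Complex.exp (Complex.I * (inner ℝ u x : ℝ)) - 1
    - (Metric.closedBall 0 1).indicator (fun y ↦ Complex.I * ((inner ℝ u y : ℝ) : ℂ)) x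

/-- The Lévy–Khintchine exponent
`i u·c - (1/2) u·Qu + ∫ (e^{i u·x} - 1 - i (u·x) 1_{|x| ≤ 1}) ν(dx)`. -/
def levyKhintchine {n : ℕ} (c : EuclideanSpace ℝ (Fin n)) (Q : Matrix (Fin n) (Fin n) ℝ)
    (ν : Measure (EuclideanSpace ℝ (Fin n))) (u : EuclideanSpace ℝ (Fin n)) : ℂ :=
  Complex.I * (inner ℝ u c : ℝ) - (1 / 2 : ℂ) * ((u.ofLp ⬝ᵥ (Q *ᵥ u.ofLp) : ℝ) : ℂ)
    + ∫ x, levyIntegrand u x ∂ν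

/-- `X` is a Lévy process started at `0` with characteristic triplet `(c, Q, ν)`. -/
structure HasLevyTriplet {Ω : Type*} [MeasurableSpace Ω] {n : ℕ} (P : Measure Ω)
    (X : ℝ≥0 → Ω → EuclideanSpace ℝ (Fin n)) (c : EuclideanSpace ℝ (Fin n))
    (Q : Matrix (Fin n) (Fin n) ℝ) (ν : Measure (EuclideanSpace ℝ (Fin n))) : Prop where
  levy : IsLevy P X
  posSemidef : Q.PosSemidef
  levyMeasure : IsLevyMeasure ν
  charFun_eq : ∀ (t : ℝ≥0) (u : EuclideanSpace ℝ (Fin n)),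
    ∫ ω, Complex.exp (Complex.I * (inner ℝ u (X t ω) : ℝ)) ∂P
      = Complex.exp ((t : ℝ) * levyKhintchine c Q ν u)

/-- The function `ψ_s(u) = -u β(s) + ∫_{(0,∞)} (e^{-ur} - 1) g(s,r) dr`. -/
def laplaceRate (β : ℝ → ℝ) (g : ℝ → ℝ → ℝ) (s : ℝ) (u : ℂ) : ℂ :=
  -u * (β s : ℂ) + ∫ r in Ioi (0 : ℝ), (Complex.exp (-u * (r : ℂ)) - 1) * (g s r : ℂ)

/-- `Z` is an additive subordinator (an additive process with values in `[0, ∞)` and nondecreasing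
càdlàg paths) with drift rate `β` and jump density `g`: its Laplace exponent is
`∫_0^t ψ_s(u) ds`. -/
structure IsAdditiveSubordinator {Ω : Type*} [MeasurableSpace Ω] (P : Measure Ω)
    (Z : ℝ≥0 → Ω → ℝ≥0) (β : ℝ → ℝ) (g : ℝ → ℝ → ℝ) : Prop where
  additive : IsAdditive P (fun t ω ↦ (Z t ω : ℝ))
  monotone : ∀ ω, Monotone fun t ↦ Z t ω
  β_continuous : ContinuousOn β (Ici 0)
  β_nonneg : ∀ s, 0 ≤ s → 0 ≤ β s
  g_continuous : ContinuousOn (fun p : ℝ × ℝ ↦ g p.1 p.2) (Ici 0 ×ˢ Ioi 0)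
  g_nonneg : ∀ s r, 0 ≤ s → 0 < r → 0 ≤ g s r
  g_integrable : ∀ s, 0 ≤ s → IntegrableOn (fun r ↦ min 1 r * g s r) (Ioi 0)
  rate_integrable : ∀ u : ℂ, 0 ≤ u.re → ∀ t : ℝ≥0,
    IntervalIntegrable (fun s ↦ laplaceRate β g s u) volume 0 t
  laplace_eq : ∀ u : ℂ, 0 ≤ u.re → ∀ t : ℝ≥0,
    ∫ ω, Complex.exp (-u * ((Z t ω : ℝ) : ℂ)) ∂P
      = Complex.exp (∫ s in (0 : ℝ)..t, laplaceRate β g s u)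

/-- The time-changed process `Y_t = X_{Z_t}`. -/
def timeChange {Ω E : Type*} (X : ℝ≥0 → Ω → E) (Z : ℝ≥0 → Ω → ℝ≥0) (t : ℝ≥0) (ω : Ω) : E :=
  X (Z t ω) ω

/-- The truncated mean `E[X_r 1_{|X_r| ≤ 1}]`, for `r ≥ 0`. -/
def truncatedMean {Ω : Type*} [MeasurableSpace Ω] {n : ℕ} (P : Measure Ω)
    (X : ℝ≥0 → Ω → EuclideanSpace ℝ (Fin n)) (r : ℝ) : EuclideanSpace ℝ (Fin n) :=
  ∫ ω, (Metric.closedBall 0 1).indicator id (X r.toNNReal ω) ∂P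

/-- The drift `c̃_s = β(s) c + ∫_{(0,∞)} E[X_r 1_{|X_r| ≤ 1}] g(s,r) dr`. -/
def newDrift {Ω : Type*} [MeasurableSpace Ω] {n : ℕ} (P : Measure Ω)
    (X : ℝ≥0 → Ω → EuclideanSpace ℝ (Fin n)) (c : EuclideanSpace ℝ (Fin n))
    (β : ℝ → ℝ) (g : ℝ → ℝ → ℝ) (s : ℝ) : EuclideanSpace ℝ (Fin n) :=
  β s • c + ∫ r in Ioi (0 : ℝ), g s r • truncatedMean P X r

/-- The jump measure `ν̃_s(dx) = β(s) ν(dx) + ∫_{(0,∞)} P(X_r ∈ dx) g(s,r) dr` on `ℝⁿ ∖ {0}`. The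
restriction matters, since the law of `X_r` may have an atom at `0`. -/
def newJumpMeasure {Ω : Type*} [MeasurableSpace Ω] {n : ℕ} (P : Measure Ω)
    (X : ℝ≥0 → Ω → EuclideanSpace ℝ (Fin n)) (ν : Measure (EuclideanSpace ℝ (Fin n)))
    (β : ℝ → ℝ) (g : ℝ → ℝ → ℝ) (s : ℝ) : Measure (EuclideanSpace ℝ (Fin n)) :=
  (ENNReal.ofReal (β s) • ν
    + ((volume.restrict (Ioi (0 : ℝ))).withDensity fun r ↦ ENNReal.ofReal (g s r)).bind
        fun r ↦ P.map (X r.toNNReal)).restrict {0}ᶜ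

/-- The additive process `Y` has time-dependent drift `c s`, Gaussian part `Q s` and jump measure
`ν s`: each `(c s, Q s, ν s)` is a Lévy triplet and the characteristic exponent of `Y_t` is
`∫_0^t Ψ_s(u) ds`, where `Ψ_s` is the Lévy–Khintchine exponent of `(c s, Q s, ν s)`. -/
structure HasCharacteristics {Ω : Type*} [MeasurableSpace Ω] {n : ℕ} (P : Measure Ω)
    (Y : ℝ≥0 → Ω → EuclideanSpace ℝ (Fin n)) (c : ℝ → EuclideanSpace ℝ (Fin n))
    (Q : ℝ → Matrix (Fin n) (Fin n) ℝ) (ν : ℝ → Measure (EuclideanSpace ℝ (Fin n))) : Prop where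
  posSemidef : ∀ s, 0 ≤ s → (Q s).PosSemidef
  levyMeasure : ∀ s, 0 ≤ s → IsLevyMeasure (ν s)
  integrable_integrand : ∀ s, 0 ≤ s → ∀ u, Integrable (levyIntegrand u) (ν s)
  exponent_integrable : ∀ (u : EuclideanSpace ℝ (Fin n)) (t : ℝ≥0),
    IntervalIntegrable (fun s ↦ levyKhintchine (c s) (Q s) (ν s) u) volume 0 t
  charFun_eq : ∀ (u : EuclideanSpace ℝ (Fin n)) (t : ℝ≥0),
    ∫ ω, Complex.exp (Complex.I * (inner ℝ u (Y t ω) : ℝ)) ∂P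
      = Complex.exp (∫ s in (0 : ℝ)..t, levyKhintchine (c s) (Q s) (ν s) u)

end

end AdditiveTimeChange

open AdditiveTimeChange

/-! Everything follows from freezing the time change. As `X` and `Z` are independent, one may
condition on a path of `Z`. The increments of `Y` are then increments of `X` along a deterministic
nondecreasing sequence of times: independent, and distributed as `X` at the increment of `Z`
(`measure_forall_increment_timeChange`). Averaging over `Z` leaves a product of functions of the
independent increments of `Z`, so `Y` has independent increments. The same conditioning gives
continuity in probability, because `Z` has no fixed discontinuities.

For the exponent, let Ψ be that of `X`. Conditioning yields E exp(iu·Y_t) = E exp(Ψ(u) Z_t), the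
Laplace transform of `Z` at -Ψ(u), a point of the closed right half-plane because characteristic
functions are bounded by 1. It remains to see that ψ_s(-Ψ(u)) = Ψ_s(u)
(`levyKhintchine_timeChange`): write exp(rΨ(u)) - 1 as the integral of exp(iu·x) - 1 against the law
of X_r, and move the truncated linear term into the drift.

This splitting needs both E[|X_r|² ∧ 1] and the truncated mean of X_r to be O(r ∧ 1), matching the
integrability of `g` (`HasLevyTriplet.exists_truncated_moments_le`). Both bounds are read off from
the characteristic function near 0, which differs from 1 by O(r). -/

namespace AdditiveTimeChange

/-! ### Joint measurability of right-continuous processes. -/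

section Measurability

variable {Ω E : Type*} [MeasurableSpace Ω] [NormedAddCommGroup E] [MeasurableSpace E] [BorelSpace E]

/-- A process with right-continuous paths is jointly measurable. -/
theorem measurable_uncurry_of_rightContinuous {X : ℝ≥0 → Ω → E} (hX : ∀ t, Measurable (X t))
    (hr : ∀ ω t, ContinuousWithinAt (fun t ↦ X t ω) (Ici t) t) :
    Measurable fun p : ℝ≥0 × Ω ↦ X p.1 p.2 := by
  -- Rounding up to a multiple of 1/(n+1): the approximation comes from the right, where paths are
  -- continuous, and takes countably many values.
  let d : ℕ → ℝ≥0 → ℝ≥0 := fun n t ↦ ((⌊((n : ℝ≥0) + 1) * t⌋₊ : ℝ≥0) + 1) / ((n : ℝ≥0) + 1)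
  have hpos (n : ℕ) : (0 : ℝ≥0) < (n : ℝ≥0) + 1 := by positivity
  have hd_ge (n : ℕ) (t : ℝ≥0) : t ≤ d n t := by
    rw [le_div_iff₀ (hpos n), mul_comm]
    exact (Nat.lt_floor_add_one _).le
  have hd_le (n : ℕ) (t : ℝ≥0) : d n t ≤ t + 1 / ((n : ℝ≥0) + 1) := by
    rw [div_le_iff₀ (hpos n), add_mul t, one_div_mul_cancel (hpos n).ne', mul_comm t]
    gcongr
    exact Nat.floor_le zero_le
  have hd_tendsto (t : ℝ≥0) : Tendsto (fun n ↦ d n t) atTop (𝓝 t) := by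
    refine tendsto_of_tendsto_of_tendsto_of_le_of_le tendsto_const_nhds ?_
      (fun n ↦ hd_ge n t) (fun n ↦ hd_le n t)
    simpa using (tendsto_const_nhds (x := t)).add
      (tendsto_one_div_add_atTop_nhds_zero_nat (𝕜 := ℝ≥0))
  refine measurable_of_tendsto_metrizable (f := fun n (p : ℝ≥0 × Ω) ↦ X (d n p.1) p.2)
    (fun n ↦ ?_) ?_
  · have h1 : Measurable fun q : ℕ × Ω ↦ X (((q.1 : ℝ≥0) + 1) / ((n : ℝ≥0) + 1)) q.2 :=
      measurable_from_prod_countable_right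
        fun k ↦ hX (((k : ℝ≥0) + 1) / ((n : ℝ≥0) + 1))
    have h2 : Measurable fun p : ℝ≥0 × Ω ↦ (⌊((n : ℝ≥0) + 1) * p.1⌋₊, p.2) := by fun_prop
    simpa only [Function.comp_def] using h1.comp h2
  · rw [tendsto_pi_nhds]
    rintro ⟨t, ω⟩
    exact (hr ω t).tendsto.comp
      (tendsto_nhdsWithin_iff.2 ⟨hd_tendsto t, .of_forall fun n ↦ hd_ge n t⟩)

/-- The event as a function of the randomness of `X` and of a separate path of clock values. The
σ-algebra on `Ω` is left free so that it can later be the one generated by `X`. -/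
theorem measurableSet_forall_increment [SecondCountableTopology E] {X : ℝ≥0 → Ω → E}
    (hX : ∀ t, Measurable (X t)) (hr : ∀ ω t, ContinuousWithinAt (fun t ↦ X t ω) (Ici t) t)
    (t : ℕ → ℝ≥0) (S : Finset ℕ) {A : ℕ → Set E} (hA : ∀ i ∈ S, MeasurableSet (A i)) :
    MeasurableSet {p : Ω × (ℝ≥0 → ℝ≥0) |
      ∀ i ∈ S, X (p.2 (t (i + 1))) p.1 - X (p.2 (t i)) p.1 ∈ A i} := by
  have hXu (s : ℝ≥0) : Measurable fun p : Ω × (ℝ≥0 → ℝ≥0) ↦ X (p.2 s) p.1 := by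
    have h : Measurable fun p : Ω × (ℝ≥0 → ℝ≥0) ↦ (p.2 s, p.1) := by fun_prop
    simpa only [Function.comp_def] using (measurable_uncurry_of_rightContinuous hX hr).comp h
  have : {p : Ω × (ℝ≥0 → ℝ≥0) | ∀ i ∈ S, X (p.2 (t (i + 1))) p.1 - X (p.2 (t i)) p.1 ∈ A i}
      = ⋂ i ∈ S, (fun p ↦ X (p.2 (t (i + 1))) p.1 - X (p.2 (t i)) p.1) ⁻¹' A i := by
    ext; simp
  rw [this]
  exact S.measurableSet_biInter fun i hi ↦ ((hXu _).sub (hXu _)) (hA i hi)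

end Measurability

/-- Events about a pair of independent variables can be computed by integrating out an independent
copy of the second one. -/
theorem measure_prodMk_mem_eq_lintegral {Ω T S : Type*} [MeasurableSpace Ω] [MeasurableSpace T]
    [MeasurableSpace S] {P : Measure Ω} [IsProbabilityMeasure P] {V : Ω → T} {W : Ω → S}
    (hV : Measurable V) (hW : Measurable W) (hind : IndepFun V W P)
    {A : Set (T × S)} (hA : MeasurableSet A) :
    P {ω | (V ω, W ω) ∈ A} = ∫⁻ ω', P {ω | (V ω, W ω') ∈ A} ∂P := by
  have := Measure.isProbabilityMeasure_map (μ := P) hV.aemeasurable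
  have := Measure.isProbabilityMeasure_map (μ := P) hW.aemeasurable
  have h1 : P {ω | (V ω, W ω) ∈ A} = P.map (fun ω ↦ (V ω, W ω)) A := by
    rw [Measure.map_apply (hV.prodMk hW) hA]
    rfl
  rw [h1, hind.map_prod_eq_prod_map_map hV.aemeasurable hW.aemeasurable,
    Measure.prod_apply_symm hA, lintegral_map (measurable_measure_prodMk_right hA) hW]
  refine lintegral_congr fun ω' ↦ ?_
  rw [Measure.map_apply hV (measurable_prodMk_right hA)]
  rfl

/-! ### Conditioning on the time change. -/

section Law

variable {Ω E : Type*} [MeasurableSpace Ω] [NormedAddCommGroup E] [MeasurableSpace E] [BorelSpace E]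
  {P : Measure Ω} {X : ℝ≥0 → Ω → E}

theorem IsAdditive.measurable_uncurry (hX : IsAdditive P X) :
    Measurable fun p : ℝ≥0 × Ω ↦ X p.1 p.2 :=
  measurable_uncurry_of_rightContinuous hX.measurable fun ω t ↦ (hX.cadlag ω t).1

theorem IsAdditive.measurable_map [SFinite P] (hX : IsAdditive P X) :
    Measurable fun r ↦ P.map (X r) := by
  refine Measure.measurable_of_measurable_coe _ fun A hA ↦ ?_
  simp_rw [Measure.map_apply (hX.measurable _) hA]
  exact measurable_measure_prodMk_left (hX.measurable_uncurry hA)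

theorem IsAdditive.measurable_timeChange (hX : IsAdditive P X) {Z : ℝ≥0 → Ω → ℝ≥0} {t : ℝ≥0}
    (hZ : Measurable (Z t)) : Measurable (timeChange X Z t) :=
  hX.measurable_uncurry.comp (hZ.prodMk measurable_id)

variable [SecondCountableTopology E] [IsProbabilityMeasure P] {Z : ℝ≥0 → Ω → ℝ≥0}

/-- By independence the path of `Z` may be replaced by an independent copy and held fixed;
independence and stationarity of the increments of `X` then factor the probability. -/
theorem measure_forall_increment_timeChange (hX : IsLevy P X) (hZm : ∀ t, Measurable (Z t))
    (hmono : ∀ ω, Monotone fun t ↦ Z t ω)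
    (hXZ : IndepFun (fun ω t ↦ X t ω) (fun ω t ↦ Z t ω) P)
    {t : ℕ → ℝ≥0} (ht : Monotone t) (S : Finset ℕ) {A : ℕ → Set E}
    (hA : ∀ i ∈ S, MeasurableSet (A i)) :
    P (⋂ i ∈ S, (fun ω ↦ timeChange X Z (t (i + 1)) ω - timeChange X Z (t i) ω) ⁻¹' A i)
      = ∫⁻ ω, ∏ i ∈ S, P.map (X (Z (t (i + 1)) ω - Z (t i) ω)) (A i) ∂P := by
  -- Evaluation at a variable time is not available as a measurable map on the full product path
  -- space. Instead `Ω` itself, with the σ-algebra generated by `X`, serves as the first space and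
  -- `id` as the first variable.
  have hm : MeasurableSpace.comap (fun ω t ↦ X t ω) inferInstance ≤ ‹MeasurableSpace Ω› :=
    measurable_iff_comap_le.1 (measurable_pi_lambda _ hX.measurable)
  have hXm (s : ℝ≥0) : Measurable[MeasurableSpace.comap (fun ω t ↦ X t ω) inferInstance] (X s) :=
    (measurable_pi_apply s).comp (comap_measurable fun ω t ↦ X t ω)
  have hset := @measurableSet_forall_increment Ω E
    (MeasurableSpace.comap (fun ω t ↦ X t ω) inferInstance) _ _ _ _ X hXm
    (fun ω t ↦ (hX.cadlag ω t).1) t S A hA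
  have hid := measurable_id'' hm
  have hind : @IndepFun Ω Ω _ _ (MeasurableSpace.comap (fun ω t ↦ X t ω) inferInstance) _
      id (fun ω t ↦ Z t ω) P := by
    have h := (IndepFun_iff_Indep _ _ _).1 hXZ
    rw [← MeasurableSpace.comap_id (m := MeasurableSpace.comap (fun ω t ↦ X t ω) _)] at h
    exact h
  have key := @measure_prodMk_mem_eq_lintegral Ω Ω _ _
    (MeasurableSpace.comap (fun ω t ↦ X t ω) inferInstance) _ P _ id (fun ω t ↦ Z t ω) hid
    (measurable_pi_lambda _ hZm) hind _ hset
  simp only [id] at key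
  have hset_eq : ⋂ i ∈ S, (fun ω ↦ timeChange X Z (t (i + 1)) ω - timeChange X Z (t i) ω) ⁻¹' A i
      = {ω | (ω, fun t ↦ Z t ω) ∈ {p : Ω × (ℝ≥0 → ℝ≥0) |
        ∀ i ∈ S, X (p.2 (t (i + 1))) p.1 - X (p.2 (t i)) p.1 ∈ A i}} := by
    ext ω; simp [timeChange]
  rw [hset_eq, key]
  refine lintegral_congr fun ω' ↦ ?_
  have hmono' : Monotone fun i ↦ Z (t i) ω' := (hmono ω').comp ht
  have hprod := (hX.indepIncrements.nat hmono').measure_inter_preimage_eq_mul S hA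
  have hset_eq' : {ω | (ω, fun t ↦ Z t ω') ∈ {p : Ω × (ℝ≥0 → ℝ≥0) |
        ∀ i ∈ S, X (p.2 (t (i + 1))) p.1 - X (p.2 (t i)) p.1 ∈ A i}}
      = ⋂ i ∈ S, (fun ω ↦ X (Z (t (i + 1)) ω') ω - X (Z (t i) ω') ω) ⁻¹' A i := by
    ext ω; simp
  rw [hset_eq', hprod]
  refine Finset.prod_congr rfl fun i hi ↦ ?_
  have hst := hX.stationary (Z (t i) ω') (Z (t (i + 1)) ω' - Z (t i) ω')
  rw [add_tsub_cancel_of_le (hmono' i.le_succ)] at hst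
  rw [← hst]
  exact (Measure.map_apply ((hX.measurable _).sub (hX.measurable _)) (hA i hi)).symm

/-- Conditionally on the time change, an increment of the time-changed process has the law of the
Lévy process at the increment of the time change. -/
theorem measure_increment_timeChange (hX : IsLevy P X) (hZm : ∀ t, Measurable (Z t))
    (hmono : ∀ ω, Monotone fun t ↦ Z t ω)
    (hXZ : IndepFun (fun ω t ↦ X t ω) (fun ω t ↦ Z t ω) P)
    {s t : ℝ≥0} (hst : s ≤ t) {A : Set E} (hA : MeasurableSet A) :
    P ((fun ω ↦ timeChange X Z t ω - timeChange X Z s ω) ⁻¹' A)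
      = ∫⁻ ω, P.map (X (Z t ω - Z s ω)) A ∂P := by
  -- A single increment is the step of index 0 of the sequence s, t, t, ….
  have hτ : Monotone fun i : ℕ ↦ if i = 0 then s else t := by
    intro i j hij
    dsimp only
    split_ifs with h1 h2 <;> first | exact le_rfl | exact hst | omega
  simpa using measure_forall_increment_timeChange hX hZm hmono hXZ hτ {0} (A := fun _ ↦ A)
    (fun _ _ ↦ hA)

/-- After conditioning, each factor is a measurable function of one increment of `Z`, so the
expectation of the product splits. -/
theorem hasIndepIncrements_timeChange (hX : IsLevy P X) (hZm : ∀ t, Measurable (Z t))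
    (hmono : ∀ ω, Monotone fun t ↦ Z t ω)
    (hZ : HasIndepIncrements (fun t ω ↦ (Z t ω : ℝ)) P)
    (hXZ : IndepFun (fun ω t ↦ X t ω) (fun ω t ↦ Z t ω) P) :
    HasIndepIncrements (timeChange X Z) P := by
  refine hasIndepIncrements_iff_nat.2 fun t ht ↦ ?_
  refine iIndepFun_iff_measure_inter_preimage_eq_mul.2 fun S A hA ↦ ?_
  rw [measure_forall_increment_timeChange hX hZm hmono hXZ ht S hA]
  -- replace the sets outside `S` by measurable ones
  classical
  let B : ℕ → Set E := fun i ↦ if i ∈ S then A i else ∅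
  have hB (i : ℕ) : MeasurableSet (B i) := by
    by_cases hi : i ∈ S
    · simpa [B, hi] using hA i hi
    · simp [B, hi]
  have hφ (i : ℕ) : Measurable fun x : ℝ ↦ P.map (X x.toNNReal) (B i) :=
    (Measure.measurable_coe (hB i)).comp
      (hX.toIsAdditive.measurable_map.comp measurable_real_toNNReal)
  have hcomp := (hZ.nat ht).comp (fun i x ↦ P.map (X x.toNNReal) (B i)) hφ
  have hincr (i : ℕ) (ω : Ω) :
      ((Z (t (i + 1)) ω : ℝ) - Z (t i) ω).toNNReal = Z (t (i + 1)) ω - Z (t i) ω := by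
    rw [← NNReal.coe_sub (hmono ω (ht i.le_succ)), Real.toNNReal_coe]
  have hprod := lintegral_prod_eq_prod_lintegral_of_indepFun S _ hcomp fun i ↦
    (hφ i).comp ((hZm _).coe_nnreal_real.sub (hZm _).coe_nnreal_real)
  simp only [Function.comp_apply, hincr] at hprod
  have hL (ω : Ω) : ∏ i ∈ S, P.map (X (Z (t (i + 1)) ω - Z (t i) ω)) (A i)
      = ∏ i ∈ S, P.map (X (Z (t (i + 1)) ω - Z (t i) ω)) (B i) :=
    Finset.prod_congr rfl fun i hi ↦ by simp [B, hi]
  simp_rw [hL]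
  rw [hprod]
  refine Finset.prod_congr rfl fun i hi ↦ ?_
  rw [measure_increment_timeChange hX hZm hmono hXZ (ht i.le_succ) (hA i hi)]
  simp [B, hi]

/-- `Y` vanishes almost surely at time 0, so its value at `t` is an increment from 0 and its law is
a mixture of the laws of `X`. -/
theorem map_timeChange (hX : IsLevy P X) (hZm : ∀ t, Measurable (Z t))
    (hmono : ∀ ω, Monotone fun t ↦ Z t ω) (hZ0 : ∀ᵐ ω ∂P, Z 0 ω = 0)
    (hXZ : IndepFun (fun ω t ↦ X t ω) (fun ω t ↦ Z t ω) P) (t : ℝ≥0) :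
    P.map (timeChange X Z t) = (P.map (Z t)).bind fun r ↦ P.map (X r) := by
  ext A hA
  have hmeas : Measurable fun r ↦ P.map (X r) A :=
    (Measure.measurable_coe hA).comp hX.toIsAdditive.measurable_map
  rw [Measure.bind_apply hA hX.toIsAdditive.measurable_map.aemeasurable,
    lintegral_map hmeas (hZm t),
    Measure.map_apply (hX.toIsAdditive.measurable_timeChange (hZm t)) hA]
  have h0 : ∀ᵐ ω ∂P, timeChange X Z 0 ω = 0 := by
    filter_upwards [hZ0, hX.zero] with ω h1 h2
    simp [timeChange, h1, h2]
  have key := measure_increment_timeChange hX hZm hmono hXZ (zero_le (a := t)) hA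
  calc P (timeChange X Z t ⁻¹' A)
      = P ((fun ω ↦ timeChange X Z t ω - timeChange X Z 0 ω) ⁻¹' A) := by
        refine measure_congr ?_
        filter_upwards [h0] with ω hω
        apply propext
        change timeChange X Z t ω ∈ A ↔ timeChange X Z t ω - timeChange X Z 0 ω ∈ A
        rw [hω, sub_zero]
    _ = ∫⁻ ω, P.map (X (Z t ω - Z 0 ω)) A ∂P := key
    _ = ∫⁻ ω, P.map (X (Z t ω)) A ∂P := by
        refine lintegral_congr_ae ?_
        filter_upwards [hZ0] with ω hω
        rw [hω, tsub_zero]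

end Law

/-! ### Càdlàg paths under a monotone clock. -/

section Paths

theorem IsCadlag.comp_monotone {E : Type*} [TopologicalSpace E] {f : ℝ≥0 → E} (hf : IsCadlag f)
    {z : ℝ≥0 → ℝ≥0} (hz : Monotone z) (hzr : ∀ t, ContinuousWithinAt z (Ici t) t) :
    IsCadlag fun t ↦ f (z t) := by
  intro t
  refine ⟨(hf (z t)).1.comp (hzr t) fun s hs ↦ hz hs, ?_⟩
  have hbdd : BddAbove (z '' Iio t) := ⟨z t, by rintro _ ⟨a, ha, rfl⟩; exact hz (le_of_lt ha)⟩
  have hlim := hz.tendsto_nhdsLT t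
  -- Either the clock reaches its left limit before `t` and is constant from there up to `t`, or it
  -- stays strictly below and the left limit of `f` applies.
  by_cases h : ∃ s < t, z s = sSup (z '' Iio t)
  · obtain ⟨s, hst, hs⟩ := h
    refine ⟨f (z s), tendsto_const_nhds.congr' ?_⟩
    filter_upwards [Ioo_mem_nhdsLT hst] with r hr
    have : z r = z s := le_antisymm (hs ▸ le_csSup hbdd ⟨r, hr.2, rfl⟩) (hz hr.1.le)
    rw [this]
  · push Not at h
    obtain ⟨l, hl⟩ := (hf (sSup (z '' Iio t))).2
    refine ⟨l, hl.comp (tendsto_nhdsWithin_iff.2 ⟨hlim, ?_⟩)⟩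
    filter_upwards [self_mem_nhdsWithin] with r hr
    exact lt_of_le_of_ne (le_csSup hbdd ⟨r, hr, rfl⟩) (h r hr)

end Paths

/-! ### Absence of fixed jumps and continuity in probability. -/

section ContinuityInProbability

variable {Ω E : Type*} [MeasurableSpace Ω] [NormedAddCommGroup E] [MeasurableSpace E] [BorelSpace E]
  {P : Measure Ω} {X : ℝ≥0 → Ω → E}

theorem IsAdditive.tendsto_map_enorm_ge [IsProbabilityMeasure P] (hX : IsAdditive P X)
    {ε : ℝ≥0∞} (hε : 0 < ε) :
    Tendsto (fun r ↦ P.map (X r) {x | ε ≤ ‖x‖ₑ}) (𝓝 0) (𝓝 0) := by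
  have hA : MeasurableSet {x : E | ε ≤ ‖x‖ₑ} := measurableSet_le measurable_const measurable_enorm
  simp_rw [Measure.map_apply (hX.measurable _) hA]
  have key := tendsto_measure_of_ae_tendsto_indicator_of_isFiniteMeasure (μ := P) (𝓝 (0 : ℝ≥0))
    (As := fun r ↦ X r ⁻¹' {x | ε ≤ ‖x‖ₑ}) MeasurableSet.empty (fun r ↦ hX.measurable r hA) ?_
  · simpa using key
  filter_upwards [hX.zero] with ω hω
  have hc : Tendsto (fun r ↦ X r ω) (𝓝 0) (𝓝 0) := by
    have h := (hX.cadlag ω 0).1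
    have hI : Ici (0 : ℝ≥0) = univ := by ext; simp
    rw [hI, continuousWithinAt_univ, ContinuousAt, hω] at h
    exact h
  have h2 : Tendsto (fun r ↦ ‖X r ω‖ₑ) (𝓝 0) (𝓝 0) := by simpa using hc.enorm
  filter_upwards [h2.eventually_lt_const hε] with r hr
  simpa using hr

variable {Z : ℝ≥0 → Ω → ℝ≥0} {β : ℝ → ℝ} {g : ℝ → ℝ → ℝ}

theorem IsAdditiveSubordinator.measurable (hZ : IsAdditiveSubordinator P Z β g) (t : ℝ≥0) :
    Measurable (Z t) := by
  have := (hZ.additive.measurable t).real_toNNReal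
  simpa using this

theorem IsAdditiveSubordinator.rightContinuous (hZ : IsAdditiveSubordinator P Z β g) (ω : Ω)
    (t : ℝ≥0) : ContinuousWithinAt (fun t ↦ Z t ω) (Ici t) t := by
  have h := continuous_real_toNNReal.continuousAt.comp_continuousWithinAt
    (hZ.additive.cadlag ω t).1
  simpa [Function.comp_def] using h

theorem IsAdditiveSubordinator.zero (hZ : IsAdditiveSubordinator P Z β g) :
    ∀ᵐ ω ∂P, Z 0 ω = 0 := by
  filter_upwards [hZ.additive.zero] with ω hω
  exact_mod_cast hω

/-- The Laplace exponent at `u = 1` is a primitive of an integrable function, hence continuous in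
`t`. -/
theorem IsAdditiveSubordinator.continuous_integral_exp_neg
    (hZ : IsAdditiveSubordinator P Z β g) :
    Continuous fun t ↦ ∫ ω, Real.exp (-(Z t ω : ℝ)) ∂P := by
  have hint : Continuous fun t : ℝ≥0 ↦ ∫ s in (0 : ℝ)..t, laplaceRate β g s 1 := by
    refine continuous_iff_continuousAt.2 fun t ↦ ?_
    have h := intervalIntegral.continuousOn_primitive_interval'
      (hZ.rate_integrable 1 (by simp) (t + 1)) (a := 0) left_mem_uIcc
    have h2 : ContinuousOn (fun t : ℝ≥0 ↦ ∫ s in (0 : ℝ)..t, laplaceRate β g s 1)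
        (Iic (t + 1)) := by
      refine h.comp NNReal.continuous_coe.continuousOn fun s hs ↦ ?_
      rw [uIcc_of_le (NNReal.coe_nonneg _)]
      exact ⟨s.coe_nonneg, NNReal.coe_le_coe.2 hs⟩
    exact h2.continuousAt (Iic_mem_nhds (lt_add_one t))
  have heq (t : ℝ≥0) : ∫ ω, Real.exp (-(Z t ω : ℝ)) ∂P
      = (Complex.exp (∫ s in (0 : ℝ)..t, laplaceRate β g s 1)).re := by
    rw [← hZ.laplace_eq 1 (by simp) t, ← Complex.ofReal_re (∫ ω, Real.exp (-(Z t ω : ℝ)) ∂P),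
      ← integral_complex_ofReal]
    simp
  simp_rw [heq]
  fun_prop

variable [IsProbabilityMeasure P]

/-- An additive subordinator has no fixed times of discontinuity. -/
theorem IsAdditiveSubordinator.ae_continuousAt (hZ : IsAdditiveSubordinator P Z β g) (t : ℝ≥0) :
    ∀ᵐ ω ∂P, ContinuousAt (fun s ↦ Z s ω) t := by
  rcases eq_or_ne t 0 with rfl | ht
  · refine .of_forall fun ω ↦ ?_
    have h := hZ.rightContinuous ω 0
    have hI : Ici (0 : ℝ≥0) = univ := by ext; simp
    rwa [hI, continuousWithinAt_univ] at h
  have : (𝓝[<] t).NeBot := nhdsLT_neBot_of_exists_lt ⟨0, pos_iff_ne_zero.2 ht⟩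
  let l : Ω → ℝ≥0 := fun ω ↦ sSup ((fun s ↦ Z s ω) '' Iio t)
  have hl (ω : Ω) : Tendsto (fun s ↦ Z s ω) (𝓝[<] t) (𝓝 (l ω)) := (hZ.monotone ω).tendsto_nhdsLT t
  have hle (ω : Ω) : l ω ≤ Z t ω := le_of_tendsto (hl ω) <| by
    filter_upwards [self_mem_nhdsWithin] with s hs using hZ.monotone ω (le_of_lt hs)
  have hexp (ω : Ω) : Tendsto (fun s ↦ Real.exp (-(Z s ω : ℝ))) (𝓝[<] t)
      (𝓝 (Real.exp (-(l ω : ℝ)))) :=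
    (Real.continuous_exp.tendsto _).comp ((NNReal.tendsto_coe.2 (hl ω)).neg)
  have hmeas (s : ℝ≥0) : Measurable fun ω ↦ Real.exp (-(Z s ω : ℝ)) := by
    have := hZ.measurable s
    fun_prop
  have hbound (x : ℝ≥0) : ‖Real.exp (-(x : ℝ))‖ ≤ 1 := by simp
  have hlim := tendsto_integral_filter_of_dominated_convergence (μ := P) (l := 𝓝[<] t)
    (F := fun s ω ↦ Real.exp (-(Z s ω : ℝ))) (f := fun ω ↦ Real.exp (-(l ω : ℝ))) (fun _ ↦ 1)
    (.of_forall fun s ↦ (hmeas s).aestronglyMeasurable)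
    (.of_forall fun s ↦ .of_forall fun ω ↦ hbound _) (integrable_const _) (.of_forall hexp)
  -- The left limit `l` is at most `Z t`. Equal expectations of a strictly decreasing function of
  -- the two force almost sure equality.
  have heq : ∫ ω, Real.exp (-(l ω : ℝ)) ∂P = ∫ ω, Real.exp (-(Z t ω : ℝ)) ∂P :=
    tendsto_nhds_unique hlim
      ((hZ.continuous_integral_exp_neg.tendsto t).mono_left nhdsWithin_le_nhds)
  have hlm : AEMeasurable (fun ω ↦ Real.exp (-(l ω : ℝ))) P :=
    aemeasurable_of_tendsto_metrizable_ae (𝓝[<] t) (fun s ↦ (hmeas s).aemeasurable)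
      (.of_forall hexp)
  have hi1 : Integrable (fun ω ↦ Real.exp (-(l ω : ℝ))) P :=
    .of_bound hlm.aestronglyMeasurable 1 (.of_forall fun ω ↦ hbound _)
  have hi2 : Integrable (fun ω ↦ Real.exp (-(Z t ω : ℝ))) P :=
    .of_bound (hmeas t).aestronglyMeasurable 1 (.of_forall fun ω ↦ hbound _)
  have hzero := (integral_eq_zero_iff_of_nonneg (μ := P)
    (f := fun ω ↦ Real.exp (-(l ω : ℝ)) - Real.exp (-(Z t ω : ℝ)))
    (fun ω ↦ by simpa using hle ω) (hi1.sub hi2)).1 (by rw [integral_sub hi1 hi2, heq, sub_self])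
  filter_upwards [hzero] with ω hω
  have hlZ : l ω = Z t ω := by
    simpa [sub_eq_zero] using hω
  refine continuousAt_iff_continuous_left_right.2 ⟨?_, hZ.rightContinuous ω t⟩
  refine continuousWithinAt_Iio_iff_Iic.1 ?_
  have := hl ω
  rwa [hlZ] at this

theorem tendstoInMeasure_timeChange [SecondCountableTopology E] (hX : IsLevy P X)
    (hZ : IsAdditiveSubordinator P Z β g)
    (hXZ : IndepFun (fun ω t ↦ X t ω) (fun ω t ↦ Z t ω) P) (t : ℝ≥0) :
    TendstoInMeasure P (timeChange X Z) (𝓝 t) (timeChange X Z t) := by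
  intro ε hε
  have hA : MeasurableSet {x : E | ε ≤ ‖x‖ₑ} := measurableSet_le measurable_const measurable_enorm
  -- Using `min` and `max` treats approach from the left and from the right at once.
  have heq (s : ℝ≥0) : P {ω | ε ≤ edist (timeChange X Z s ω) (timeChange X Z t ω)}
      = ∫⁻ ω, P.map (X (Z (max s t) ω - Z (min s t) ω)) {x | ε ≤ ‖x‖ₑ} ∂P := by
    rw [← measure_increment_timeChange hX hZ.measurable hZ.monotone hXZ min_le_max hA]
    congr 1
    ext ω
    rcases le_total s t with h | h
    · simp [h, edist_eq_enorm_sub, enorm_sub_rev]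
    · simp [h, edist_eq_enorm_sub]
  simp_rw [heq]
  have hm : Measurable fun r ↦ P.map (X r) {x | ε ≤ ‖x‖ₑ} :=
    (Measure.measurable_coe hA).comp hX.toIsAdditive.measurable_map
  rw [← lintegral_zero (μ := P)]
  refine tendsto_lintegral_filter_of_dominated_convergence (fun _ ↦ 1)
    (.of_forall fun s ↦ hm.comp ((hZ.measurable _).sub (hZ.measurable _)))
    (.of_forall fun s ↦ .of_forall fun ω ↦ ?_) (by simp) ?_
  · have := Measure.isProbabilityMeasure_map (μ := P)
      (hX.measurable (Z (max s t) ω - Z (min s t) ω)).aemeasurable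
    exact prob_le_one
  · filter_upwards [hZ.ae_continuousAt t] with ω hω
    refine (hX.toIsAdditive.tendsto_map_enorm_ge hε).comp ?_
    have h1 : Tendsto (fun s ↦ Z (max s t) ω) (𝓝 t) (𝓝 (Z t ω)) := by
      refine hω.tendsto.comp ?_
      simpa using (tendsto_id (x := 𝓝 t)).max (tendsto_const_nhds (x := t))
    have h2 : Tendsto (fun s ↦ Z (min s t) ω) (𝓝 t) (𝓝 (Z t ω)) := by
      refine hω.tendsto.comp ?_
      simpa using (tendsto_id (x := 𝓝 t)).min (tendsto_const_nhds (x := t))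
    simpa using h1.sub h2

theorem isAdditive_timeChange [SecondCountableTopology E] (hX : IsLevy P X)
    (hZ : IsAdditiveSubordinator P Z β g)
    (hXZ : IndepFun (fun ω t ↦ X t ω) (fun ω t ↦ Z t ω) P) :
    IsAdditive P (timeChange X Z) where
  measurable t := hX.toIsAdditive.measurable_timeChange (hZ.measurable t)
  zero := by
    filter_upwards [hZ.zero, hX.zero] with ω h1 h2
    simp [timeChange, h1, h2]
  indepIncrements := hasIndepIncrements_timeChange hX hZ.measurable hZ.monotone
    hZ.additive.indepIncrements hXZ
  cadlag ω := (hX.cadlag ω).comp_monotone (hZ.monotone ω) (hZ.rightContinuous ω)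

end ContinuityInProbability

/-! ### Estimates for the Lévy–Khintchine exponent. -/

section Exponent

/-- Mean value inequality on the left half-plane, which is convex and on which the derivative of
`exp` has norm at most 1. -/
theorem norm_exp_sub_one_le_of_re_nonpos {z : ℂ} (hz : z.re ≤ 0) : ‖Complex.exp z - 1‖ ≤ ‖z‖ := by
  have h := (convex_halfSpace_re_le (0 : ℝ)).norm_image_sub_le_of_norm_deriv_le
    (f := Complex.exp) (C := 1) (x := 0) (y := z) (fun w _ ↦ Complex.differentiableAt_exp)
    (fun w hw ↦ by
      rw [Complex.deriv_exp, Complex.norm_exp]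
      exact Real.exp_le_one_iff.2 hw) (by simp) hz
  simpa using h

theorem norm_exp_I_mul_sub_one_sub_le (y : ℝ) :
    ‖Complex.exp (Complex.I * y) - 1 - Complex.I * y‖ ≤ 3 * y ^ 2 := by
  have hn : ‖Complex.I * (y : ℂ)‖ = |y| := by simp
  rcases le_total |y| 1 with h | h
  · have := Complex.norm_exp_sub_one_sub_id_le (x := Complex.I * y) (hn.trans_le h)
    rw [hn, sq_abs] at this
    nlinarith [sq_nonneg y]
  · have h1 : ‖Complex.exp (Complex.I * y) - 1 - Complex.I * y‖ ≤ |y| + |y| := by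
      refine (norm_sub_le _ _).trans (add_le_add ?_ hn.le)
      simpa using Real.norm_exp_I_mul_ofReal_sub_one_le (x := y)
    nlinarith [sq_abs y]

variable {n : ℕ}

theorem measurable_levyIntegrand (u : EuclideanSpace ℝ (Fin n)) : Measurable (levyIntegrand u) := by
  unfold levyIntegrand
  refine Measurable.sub (by fun_prop) ?_
  exact Measurable.indicator (by fun_prop) Metric.isClosed_closedBall.measurableSet

theorem levyIntegrand_zero (u : EuclideanSpace ℝ (Fin n)) : levyIntegrand u 0 = 0 := by
  simp [levyIntegrand]

theorem norm_levyIntegrand_le (u x : EuclideanSpace ℝ (Fin n)) :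
    ‖levyIntegrand u x‖ ≤ (3 * ‖u‖ ^ 2 + 2) * min (‖x‖ ^ 2) 1 := by
  have habs := abs_real_inner_le_norm u x
  rcases le_or_gt ‖x‖ 1 with h | h
  · have hmem : x ∈ Metric.closedBall (0 : EuclideanSpace ℝ (Fin n)) 1 := by simpa using h
    have hmin : min (‖x‖ ^ 2) 1 = ‖x‖ ^ 2 := min_eq_left (pow_le_one₀ (norm_nonneg _) h)
    rw [levyIntegrand, indicator_of_mem hmem, hmin]
    refine (norm_exp_I_mul_sub_one_sub_le _).trans ?_
    have : inner ℝ u x ^ 2 ≤ (‖u‖ * ‖x‖) ^ 2 := sq_le_sq' (abs_le.1 habs).1 (abs_le.1 habs).2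
    nlinarith [sq_nonneg ‖x‖]
  · have hmem : x ∉ Metric.closedBall (0 : EuclideanSpace ℝ (Fin n)) 1 := by simpa using h
    have hmin : min (‖x‖ ^ 2) 1 = 1 := min_eq_right (one_le_pow₀ h.le)
    rw [levyIntegrand, indicator_of_notMem hmem, hmin, sub_zero]
    refine (norm_sub_le _ _).trans ?_
    rw [mul_comm Complex.I, Complex.norm_exp_ofReal_mul_I, norm_one]
    nlinarith [sq_nonneg ‖u‖]

theorem integrable_min_of_lintegral_lt_top {ν : Measure (EuclideanSpace ℝ (Fin n))}
    (hν : ∫⁻ x, ENNReal.ofReal (min (‖x‖ ^ 2) 1) ∂ν < ∞) :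
    Integrable (fun x ↦ min (‖x‖ ^ 2) 1) ν := by
  refine ⟨by fun_prop, ?_⟩
  rwa [hasFiniteIntegral_iff_ofReal (.of_forall fun x ↦ by positivity)]

theorem integrable_levyIntegrand_of_lintegral_lt_top {ν : Measure (EuclideanSpace ℝ (Fin n))}
    (hν : ∫⁻ x, ENNReal.ofReal (min (‖x‖ ^ 2) 1) ∂ν < ∞) (u : EuclideanSpace ℝ (Fin n)) :
    Integrable (levyIntegrand u) ν :=
  ((integrable_min_of_lintegral_lt_top hν).const_mul (3 * ‖u‖ ^ 2 + 2)).mono'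
    (measurable_levyIntegrand u).aestronglyMeasurable (.of_forall fun x ↦ norm_levyIntegrand_le u x)

/-- Used with `a` a coordinate vector; the range of `t` is the one needed by the tail estimate of
`integral_min_sq_one_le`. -/
theorem exists_norm_levyKhintchine_smul_le (c : EuclideanSpace ℝ (Fin n))
    (Q : Matrix (Fin n) (Fin n) ℝ) {ν : Measure (EuclideanSpace ℝ (Fin n))}
    (hν : IsLevyMeasure ν) (a : EuclideanSpace ℝ (Fin n)) :
    ∃ K, 0 ≤ K ∧ ∀ t : ℝ, |t| ≤ 2 → ‖levyKhintchine c Q ν (t • a)‖ ≤ K := by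
  let I := ∫ x, min (‖x‖ ^ 2) 1 ∂ν
  have hI : 0 ≤ I := integral_nonneg fun x ↦ by positivity
  refine ⟨2 * ‖a‖ * ‖c‖ + 2 * |a.ofLp ⬝ᵥ (Q *ᵥ a.ofLp)| + (3 * (2 * ‖a‖) ^ 2 + 2) * I,
    by positivity, fun t ht ↦ ?_⟩
  have hta : ‖t • a‖ ≤ 2 * ‖a‖ := by
    rw [norm_smul, Real.norm_eq_abs]
    gcongr
  have h1 : ‖Complex.I * ((inner ℝ (t • a) c : ℝ) : ℂ)‖ ≤ 2 * ‖a‖ * ‖c‖ := by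
    rw [norm_mul, Complex.norm_I, one_mul, Complex.norm_real]
    refine (norm_inner_le_norm _ _).trans ?_
    gcongr
  have h2 : ‖(1 / 2 : ℂ) * (((t • a).ofLp ⬝ᵥ (Q *ᵥ (t • a).ofLp) : ℝ) : ℂ)‖
      ≤ 2 * |a.ofLp ⬝ᵥ (Q *ᵥ a.ofLp)| := by
    have : (t • a).ofLp ⬝ᵥ (Q *ᵥ (t • a).ofLp) = t ^ 2 * (a.ofLp ⬝ᵥ (Q *ᵥ a.ofLp)) := by
      simp only [WithLp.ofLp_smul, Matrix.mulVec_smul, smul_dotProduct, dotProduct_smul,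
        smul_eq_mul]
      ring
    rw [this, norm_mul, Complex.norm_real, Real.norm_eq_abs, abs_mul, abs_pow]
    have h4 : |t| ^ 2 ≤ 4 := by nlinarith [abs_nonneg t]
    have h5 : ‖(1 / 2 : ℂ)‖ = 1 / 2 := by norm_num
    rw [h5]
    nlinarith [abs_nonneg (a.ofLp ⬝ᵥ (Q *ᵥ a.ofLp))]
  have h3 : ‖∫ x, levyIntegrand (t • a) x ∂ν‖ ≤ (3 * (2 * ‖a‖) ^ 2 + 2) * I := by
    rw [← integral_const_mul]
    refine norm_integral_le_of_norm_le ((integrable_min_of_lintegral_lt_top hν.2).const_mul _)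
      (.of_forall fun x ↦ ?_)
    refine (norm_levyIntegrand_le _ x).trans ?_
    gcongr
  rw [levyKhintchine]
  exact (norm_add_le _ _).trans (add_le_add ((norm_sub_le _ _).trans (add_le_add h1 h2)) h3)

end Exponent

/-! ### Truncated moments from the characteristic function near 0. -/

section TruncatedMoments

variable {Ω : Type*} [MeasurableSpace Ω] {P : Measure Ω} [IsProbabilityMeasure P]

theorem integrable_exp_I_mul {y : Ω → ℝ} (hy : Measurable y) :
    Integrable (fun ω ↦ Complex.exp (Complex.I * (y ω : ℂ))) P := by
  refine .of_bound (C := 1) (by fun_prop) (.of_forall fun ω ↦ ?_)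
  rw [mul_comm, Complex.norm_exp_ofReal_mul_I]

theorem integral_one_sub_cos_le {y : Ω → ℝ} (hy : Measurable y) {M : ℝ}
    (hM : ‖∫ ω, Complex.exp (Complex.I * (y ω : ℂ)) ∂P - 1‖ ≤ M) :
    ∫ ω, (1 - Real.cos (y ω)) ∂P ≤ M := by
  have h1 : ∫ ω, Real.cos (y ω) ∂P = (∫ ω, Complex.exp (Complex.I * (y ω : ℂ)) ∂P).re := by
    rw [← RCLike.re_eq_complex_re, ← integral_re (integrable_exp_I_mul hy)]
    refine integral_congr_ae (.of_forall fun ω ↦ ?_)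
    simp only [RCLike.re_eq_complex_re]
    rw [mul_comm, Complex.exp_ofReal_mul_I_re]
  have hc : Integrable (fun ω ↦ Real.cos (y ω)) P :=
    .of_bound (C := 1) (by fun_prop) (.of_forall fun ω ↦ Real.abs_cos_le_one _)
  rw [integral_sub (integrable_const _) hc, h1]
  have := (Complex.abs_re_le_norm (∫ ω, Complex.exp (Complex.I * (y ω : ℂ)) ∂P - 1)).trans hM
  rw [Complex.sub_re, Complex.one_re] at this
  simp only [integral_const, probReal_univ, one_smul]
  linarith [(abs_le.1 this).1]

theorem abs_integral_sin_le {y : Ω → ℝ} (hy : Measurable y) {M : ℝ}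
    (hM : ‖∫ ω, Complex.exp (Complex.I * (y ω : ℂ)) ∂P - 1‖ ≤ M) :
    |∫ ω, Real.sin (y ω) ∂P| ≤ M := by
  have h1 : ∫ ω, Real.sin (y ω) ∂P = (∫ ω, Complex.exp (Complex.I * (y ω : ℂ)) ∂P).im := by
    rw [← RCLike.im_eq_complex_im, ← integral_im (integrable_exp_I_mul hy)]
    refine integral_congr_ae (.of_forall fun ω ↦ ?_)
    simp only [RCLike.im_eq_complex_im]
    rw [mul_comm, Complex.exp_ofReal_mul_I_im]
  have := (Complex.abs_im_le_norm (∫ ω, Complex.exp (Complex.I * (y ω : ℂ)) ∂P - 1)).trans hM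
  rwa [Complex.sub_im, Complex.one_im, sub_zero, ← h1] at this

/-- On [-1, 1] the cosine is at most 1 - (2/π²)y², and 2/π² ≥ 1/5; outside, the indicator suffices.
-/
theorem min_sq_one_le (y : ℝ) :
    min (y ^ 2) 1 ≤ 5 * (1 - Real.cos y) + {x : ℝ | 1 < |x|}.indicator 1 y := by
  rcases le_or_gt |y| 1 with h | h
  · have hmem : y ∉ {x : ℝ | 1 < |x|} := by simpa using h
    rw [indicator_of_notMem hmem, add_zero]
    refine (min_le_left _ _).trans ?_
    have hb := Real.cos_le_one_sub_mul_cos_sq (x := y) (h.trans (by linarith [Real.pi_gt_three]))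
    have hpi : (1 : ℝ) / 5 ≤ 2 / Real.pi ^ 2 := by
      rw [div_le_div_iff₀ (by norm_num) (by positivity)]
      nlinarith [Real.pi_lt_d2, Real.pi_pos]
    nlinarith [sq_nonneg y]
  · have hmem : y ∈ {x : ℝ | 1 < |x|} := h
    rw [indicator_of_mem hmem]
    simp only [Pi.one_apply]
    linarith [min_le_right (y ^ 2) 1, Real.cos_le_one y]

/-- Control of the truncated second moment by the characteristic function near `0`. -/
theorem integral_min_sq_one_le {y : Ω → ℝ} (hy : Measurable y) {M : ℝ}
    (hM : ∀ t : ℝ, |t| ≤ 2 → ‖∫ ω, Complex.exp (Complex.I * ((t * y ω : ℝ) : ℂ)) ∂P - 1‖ ≤ M) :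
    ∫ ω, min (y ω ^ 2) 1 ∂P ≤ 7 * M := by
  have hset : MeasurableSet {x : ℝ | 1 < |x|} := measurableSet_lt measurable_const (by fun_prop)
  have hcos : Integrable (fun ω ↦ 5 * (1 - Real.cos (y ω))) P :=
    ((integrable_const _).sub (.of_bound (C := 1) (by fun_prop)
      (.of_forall fun ω ↦ Real.abs_cos_le_one _))).const_mul 5
  have hind : Integrable (fun ω ↦ {x : ℝ | 1 < |x|}.indicator (1 : ℝ → ℝ) (y ω)) P := by
    refine .of_bound (C := 1) ((measurable_one.indicator hset).comp hy).aestronglyMeasurable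
      (.of_forall fun ω ↦ ?_)
    refine (norm_indicator_le_norm_self _ _).trans (by simp)
  have hmin : Integrable (fun ω ↦ min (y ω ^ 2) 1) P := by
    refine .of_bound (C := 1) (by fun_prop) (.of_forall fun ω ↦ ?_)
    rw [Real.norm_of_nonneg (by positivity)]
    exact min_le_right _ _
  have htail : ∫ ω, {x : ℝ | 1 < |x|}.indicator (1 : ℝ → ℝ) (y ω) ∂P ≤ 2 * M := by
    have := Measure.isProbabilityMeasure_map (μ := P) hy.aemeasurable
    -- At threshold 1 the tail is at most half the norm of the integral of 1 - φ over [-2, 2], hence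
    -- at most 2M. With the 5M from the cosine term this gives the constant 7.
    have h1 := measureReal_abs_gt_le_integral_charFun (μ := P.map y) one_pos
    have h2 : ∫ ω, {x : ℝ | 1 < |x|}.indicator (1 : ℝ → ℝ) (y ω) ∂P
        = (P.map y).real {x | 1 < |x|} := by
      rw [← integral_indicator_one hset,
        integral_map hy.aemeasurable (measurable_one.indicator hset).aestronglyMeasurable]
    have h3 : ‖∫ t in (-2 * (1 : ℝ)⁻¹)..(2 * (1 : ℝ)⁻¹), 1 - charFun (P.map y) t‖
        ≤ M * |2 * (1 : ℝ)⁻¹ - (-2 * (1 : ℝ)⁻¹)| := by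
      refine intervalIntegral.norm_integral_le_of_norm_le_const fun t ht ↦ ?_
      have ht' : |t| ≤ 2 := by
        rw [uIoc_of_le (by norm_num)] at ht
        rw [abs_le]
        constructor <;> linarith [ht.1, ht.2]
      rw [norm_sub_rev, charFun_apply_real,
        integral_map hy.aemeasurable (by fun_prop)]
      have hcomm : (fun ω ↦ Complex.exp (t * y ω * Complex.I))
          = fun ω ↦ Complex.exp (Complex.I * ((t * y ω : ℝ) : ℂ)) := by
        ext ω
        push_cast
        rw [mul_comm]
      rw [hcomm]
      exact hM t ht'
    rw [h2]
    refine h1.trans ?_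
    norm_num at h3 ⊢
    linarith
  calc ∫ ω, min (y ω ^ 2) 1 ∂P
      ≤ ∫ ω, (5 * (1 - Real.cos (y ω)) + {x : ℝ | 1 < |x|}.indicator (1 : ℝ → ℝ) (y ω)) ∂P :=
        integral_mono hmin (hcos.add hind) fun ω ↦ min_sq_one_le (y ω)
    _ = 5 * ∫ ω, (1 - Real.cos (y ω)) ∂P
        + ∫ ω, {x : ℝ | 1 < |x|}.indicator (1 : ℝ → ℝ) (y ω) ∂P := by
        rw [integral_add hcos hind, integral_const_mul]
    _ ≤ 7 * M := by
        have := integral_one_sub_cos_le (P := P) hy (by simpa using hM 1 (by norm_num))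
        linarith

variable {n : ℕ} {Y : Ω → EuclideanSpace ℝ (Fin n)}

theorem integrable_min_norm_sq (hY : Measurable Y) :
    Integrable (fun ω ↦ min (‖Y ω‖ ^ 2) 1) P := by
  refine .of_bound (C := 1) (by fun_prop) (.of_forall fun ω ↦ ?_)
  rw [Real.norm_of_nonneg (by positivity)]
  exact min_le_right _ _

theorem integral_min_norm_sq_le (hY : Measurable Y) {M : ℝ}
    (hM : ∀ i, ∀ t : ℝ, |t| ≤ 2 →
      ‖∫ ω, Complex.exp (Complex.I * ((t * Y ω i : ℝ) : ℂ)) ∂P - 1‖ ≤ M) :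
    ∫ ω, min (‖Y ω‖ ^ 2) 1 ∂P ≤ n * (7 * M) := by
  have hYi (i : Fin n) : Measurable fun ω ↦ Y ω i := by fun_prop
  have hint (i : Fin n) : Integrable (fun ω ↦ min (Y ω i ^ 2) 1) P := by
    refine .of_bound (C := 1) (by fun_prop) (.of_forall fun ω ↦ ?_)
    rw [Real.norm_of_nonneg (by positivity)]
    exact min_le_right _ _
  have hle (ω : Ω) : min (‖Y ω‖ ^ 2) 1 ≤ ∑ i, min (Y ω i ^ 2) 1 := by
    by_cases h : ∃ i, 1 ≤ Y ω i ^ 2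
    · obtain ⟨i, hi⟩ := h
      calc min (‖Y ω‖ ^ 2) 1 ≤ 1 := min_le_right _ _
        _ = min (Y ω i ^ 2) 1 := (min_eq_right hi).symm
        _ ≤ _ := Finset.single_le_sum (f := fun i ↦ min (Y ω i ^ 2) 1)
          (fun j _ ↦ by positivity) (Finset.mem_univ i)
    · push Not at h
      refine (min_le_left _ _).trans ?_
      rw [EuclideanSpace.real_norm_sq_eq]
      exact Finset.sum_le_sum fun i _ ↦ (min_eq_left (h i).le).ge
  calc ∫ ω, min (‖Y ω‖ ^ 2) 1 ∂P ≤ ∫ ω, ∑ i, min (Y ω i ^ 2) 1 ∂P :=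
        integral_mono (integrable_min_norm_sq hY) (integrable_finsetSum _ fun i _ ↦ hint i) hle
    _ = ∑ i, ∫ ω, min (Y ω i ^ 2) 1 ∂P := integral_finsetSum _ fun i _ ↦ hint i
    _ ≤ ∑ _i : Fin n, 7 * M := Finset.sum_le_sum fun i _ ↦ integral_min_sq_one_le (hYi i) (hM i)
    _ = n * (7 * M) := by simp

theorem norm_indicator_closedBall_le (x : EuclideanSpace ℝ (Fin n)) :
    ‖(Metric.closedBall (0 : EuclideanSpace ℝ (Fin n)) 1).indicator id x‖ ≤ 1 := by
  by_cases hx : x ∈ Metric.closedBall (0 : EuclideanSpace ℝ (Fin n)) 1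
  · rw [indicator_of_mem hx]
    simpa using hx
  · rw [indicator_of_notMem hx]
    simp

theorem measurable_indicator_closedBall :
    Measurable ((Metric.closedBall (0 : EuclideanSpace ℝ (Fin n)) 1).indicator id) :=
  measurable_id.indicator Metric.isClosed_closedBall.measurableSet

theorem integrable_indicator_closedBall (hY : Measurable Y) :
    Integrable (fun ω ↦ (Metric.closedBall (0 : EuclideanSpace ℝ (Fin n)) 1).indicator id (Y ω))
      P :=
  .of_bound (C := 1) (measurable_indicator_closedBall.comp hY).aestronglyMeasurable
    (.of_forall fun _ ↦ norm_indicator_closedBall_le _)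

theorem EuclideanSpace.norm_le_sum_abs (x : EuclideanSpace ℝ (Fin n)) : ‖x‖ ≤ ∑ i, |x i| := by
  rw [EuclideanSpace.norm_eq]
  refine Real.sqrt_le_iff.2 ⟨Finset.sum_nonneg fun i _ ↦ abs_nonneg _, ?_⟩
  simp only [Real.norm_eq_abs]
  exact Finset.sum_sq_le_sq_sum_of_nonneg fun i _ ↦ abs_nonneg _

/-- Each truncated coordinate is compared with its sine: the mean of the sine is an imaginary part
of the characteristic function, and the error is at most |Y|² ∧ 1. -/
theorem norm_integral_indicator_closedBall_le (hY : Measurable Y) {M : ℝ}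
    (hM : ∀ i, ∀ t : ℝ, |t| ≤ 2 →
      ‖∫ ω, Complex.exp (Complex.I * ((t * Y ω i : ℝ) : ℂ)) ∂P - 1‖ ≤ M) :
    ‖∫ ω, (Metric.closedBall (0 : EuclideanSpace ℝ (Fin n)) 1).indicator id (Y ω) ∂P‖
      ≤ n * (M + n * (7 * M)) := by
  refine (EuclideanSpace.norm_le_sum_abs _).trans ?_
  have hYi (i : Fin n) : Measurable fun ω ↦ Y ω i := by fun_prop
  have hint := integrable_indicator_closedBall (P := P) hY
  calc _ ≤ ∑ _i : Fin n, (M + n * (7 * M)) := Finset.sum_le_sum fun i _ ↦ ?_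
    _ = _ := by rw [Finset.sum_const, Finset.card_univ, Fintype.card_fin, nsmul_eq_mul]
  have hcoord : (∫ ω, (Metric.closedBall (0 : EuclideanSpace ℝ (Fin n)) 1).indicator id (Y ω) ∂P) i
      = ∫ ω, (Metric.closedBall (0 : EuclideanSpace ℝ (Fin n)) 1).indicator id (Y ω) i ∂P :=
    ((EuclideanSpace.proj (𝕜 := ℝ) i).integral_comp_comm hint).symm
  have hinti : Integrable (fun ω ↦
      (Metric.closedBall (0 : EuclideanSpace ℝ (Fin n)) 1).indicator id (Y ω) i) P :=
    (EuclideanSpace.proj (𝕜 := ℝ) i).integrable_comp hint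
  have hsin : Integrable (fun ω ↦ Real.sin (Y ω i)) P :=
    .of_bound (C := 1) (by fun_prop) (.of_forall fun ω ↦ Real.abs_sin_le_one _)
  have hdiff (ω : Ω) :
      ‖(Metric.closedBall (0 : EuclideanSpace ℝ (Fin n)) 1).indicator id (Y ω) i
        - Real.sin (Y ω i)‖ ≤ min (‖Y ω‖ ^ 2) 1 := by
    rcases le_or_gt ‖Y ω‖ 1 with h | h
    · have hmem : Y ω ∈ Metric.closedBall (0 : EuclideanSpace ℝ (Fin n)) 1 := by simpa using h
      rw [indicator_of_mem hmem, min_eq_left (pow_le_one₀ (norm_nonneg _) h), id]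
      refine (Real.abs_sub_sin_le _).trans ?_
      have h1 : |Y ω i| ≤ ‖Y ω‖ := PiLp.norm_apply_le (Y ω) i
      have h0 := abs_nonneg (Y ω i)
      have h2 : |Y ω i| ^ 2 ≤ ‖Y ω‖ ^ 2 := pow_le_pow_left₀ h0 h1 2
      nlinarith [sq_nonneg |Y ω i|]
    · have hmem : Y ω ∉ Metric.closedBall (0 : EuclideanSpace ℝ (Fin n)) 1 := by simpa using h
      rw [indicator_of_notMem hmem, min_eq_right (one_le_pow₀ h.le)]
      simpa using Real.abs_sin_le_one _
  rw [hcoord]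
  have hsplit : ∫ ω, (Metric.closedBall (0 : EuclideanSpace ℝ (Fin n)) 1).indicator id (Y ω) i ∂P
      = ∫ ω, Real.sin (Y ω i) ∂P
        + ∫ ω, ((Metric.closedBall (0 : EuclideanSpace ℝ (Fin n)) 1).indicator id (Y ω) i
        - Real.sin (Y ω i)) ∂P := by
    rw [integral_sub hinti hsin]
    ring
  rw [hsplit]
  refine (abs_add_le _ _).trans (add_le_add ?_ ?_)
  · exact abs_integral_sin_le (hYi i) (by simpa using hM i 1 (by norm_num))
  · exact (norm_integral_le_of_norm_le (integrable_min_norm_sq hY) (.of_forall hdiff)).trans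
      (integral_min_norm_sq_le hY hM)

end TruncatedMoments

/-! ### Small-time moment bounds for the Lévy process. -/

section LevyBounds

variable {Ω : Type*} [MeasurableSpace Ω] {n : ℕ} {P : Measure Ω} [IsProbabilityMeasure P]
  {X : ℝ≥0 → Ω → EuclideanSpace ℝ (Fin n)} {c : EuclideanSpace ℝ (Fin n)}
  {Q : Matrix (Fin n) (Fin n) ℝ} {ν : Measure (EuclideanSpace ℝ (Fin n))}

theorem HasLevyTriplet.re_levyKhintchine_nonpos (hX : HasLevyTriplet P X c Q ν)
    (u : EuclideanSpace ℝ (Fin n)) : (levyKhintchine c Q ν u).re ≤ 0 := by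
  have h := hX.charFun_eq 1 u
  have hle : ‖∫ ω, Complex.exp (Complex.I * (inner ℝ u (X 1 ω) : ℝ)) ∂P‖ ≤ 1 := by
    refine (norm_integral_le_integral_norm _).trans_eq ?_
    simp [mul_comm Complex.I, Complex.norm_exp_ofReal_mul_I]
  rw [h, Complex.norm_exp] at hle
  simpa using hle

/-- The truncated first two moments of a Lévy process are `O(t)`. -/
theorem HasLevyTriplet.exists_truncated_moments_le (hX : HasLevyTriplet P X c Q ν) :
    ∃ C, 0 ≤ C ∧ ∀ r : ℝ≥0, ∫ ω, min (‖X r ω‖ ^ 2) 1 ∂P ≤ C * min 1 (r : ℝ) ∧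
      ‖∫ ω, (Metric.closedBall (0 : EuclideanSpace ℝ (Fin n)) 1).indicator id (X r ω) ∂P‖
        ≤ C * min 1 (r : ℝ) := by
  choose K hK0 hK using fun i : Fin n ↦
    exists_norm_levyKhintchine_smul_le c Q hX.levyMeasure (EuclideanSpace.single i (1 : ℝ))
  let K' := ∑ i, K i
  have hK' : 0 ≤ K' := Finset.sum_nonneg fun i _ ↦ hK0 i
  have hM (r : ℝ≥0) (i : Fin n) (t : ℝ) (ht : |t| ≤ 2) :
      ‖∫ ω, Complex.exp (Complex.I * ((t * X r ω i : ℝ) : ℂ)) ∂P - 1‖ ≤ K' * r := by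
    have h := hX.charFun_eq r (t • EuclideanSpace.single i (1 : ℝ))
    simp only [inner_smul_left, EuclideanSpace.inner_single_left, map_one, one_mul,
      RCLike.conj_to_real] at h
    rw [h]
    refine (norm_exp_sub_one_le_of_re_nonpos ?_).trans ?_
    · rw [Complex.re_ofReal_mul]
      exact mul_nonpos_of_nonneg_of_nonpos r.coe_nonneg (hX.re_levyKhintchine_nonpos _)
    · rw [norm_mul, Complex.norm_real, Real.norm_of_nonneg r.coe_nonneg, mul_comm]
      gcongr
      exact (hK i t ht).trans (Finset.single_le_sum (fun j _ ↦ hK0 j) (Finset.mem_univ i))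
  -- The summand 1 covers the trivial bound for large `r`, the other two the linear bounds of the
  -- second and first moments.
  let C := 1 + n * (7 * K') + n * (K' + n * (7 * K'))
  have hC1 : 1 ≤ C := by
    have : 0 ≤ n * (7 * K') + n * (K' + n * (7 * K')) := by positivity
    simp only [C]
    linarith
  have hmin {x : ℝ} {r : ℝ≥0} (h1 : x ≤ 1) (h2 : x ≤ C * r) : x ≤ C * min 1 (r : ℝ) := by
    rw [mul_min_of_nonneg _ _ (zero_le_one.trans hC1)]
    exact le_min (by linarith) h2
  refine ⟨C, zero_le_one.trans hC1, fun r ↦ ⟨hmin ?_ ?_, hmin ?_ ?_⟩⟩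
  · calc ∫ ω, min (‖X r ω‖ ^ 2) 1 ∂P ≤ ∫ _, 1 ∂P :=
          integral_mono (integrable_min_norm_sq (hX.levy.measurable r)) (integrable_const _)
            fun ω ↦ min_le_right _ _
      _ = 1 := by simp
  · refine (integral_min_norm_sq_le (hX.levy.measurable r) (hM r)).trans ?_
    calc n * (7 * (K' * r)) = n * (7 * K') * r := by ring
      _ ≤ C * r := by
        have : 0 ≤ 1 + n * (K' + n * (7 * K')) := by positivity
        gcongr
        simp only [C]
        linarith
  · refine (norm_integral_le_integral_norm _).trans ?_
    calc _ ≤ ∫ _, 1 ∂P :=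
          integral_mono (integrable_indicator_closedBall (hX.levy.measurable r)).norm
            (integrable_const _) fun ω ↦ norm_indicator_closedBall_le _
      _ = 1 := by simp
  · refine (norm_integral_indicator_closedBall_le (hX.levy.measurable r) (hM r)).trans ?_
    calc n * (K' * r + n * (7 * (K' * r))) = n * (K' + n * (7 * K')) * r := by ring
      _ ≤ C * r := by
        have : 0 ≤ 1 + n * (7 * K') := by positivity
        gcongr
        simp only [C]
        linarith

end LevyBounds

theorem integral_bind {α γ F : Type*} [MeasurableSpace α] [MeasurableSpace γ]
    [NormedAddCommGroup F] [NormedSpace ℝ F] {m : Measure α} {κ : α → Measure γ}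
    (hκ : Measurable κ) {f : γ → F} (hf : Integrable f (m.bind κ)) :
    ∫ x, f x ∂(m.bind κ) = ∫ a, ∫ x, f x ∂(κ a) ∂m :=
  Kernel.integral_comp (κ := Kernel.const Unit m) (η := ⟨κ, hκ⟩) (a := ()) hf

/-! ### The mixed jump measure and the identity of exponents. -/

section Mixture

variable {Ω : Type*} [MeasurableSpace Ω] {n : ℕ} {P : Measure Ω}
  {X : ℝ≥0 → Ω → EuclideanSpace ℝ (Fin n)} {c : EuclideanSpace ℝ (Fin n)}
  {Q : Matrix (Fin n) (Fin n) ℝ} {ν : Measure (EuclideanSpace ℝ (Fin n))}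
  {Z : ℝ≥0 → Ω → ℝ≥0} {β : ℝ → ℝ} {g : ℝ → ℝ → ℝ}

theorem IsAdditiveSubordinator.aemeasurable_density (hZ : IsAdditiveSubordinator P Z β g) {s : ℝ}
    (hs : 0 ≤ s) : AEMeasurable (g s) (volume.restrict (Ioi 0)) := by
  have h : ContinuousOn (g s) (Ioi 0) :=
    hZ.g_continuous.comp (f := fun r ↦ (s, r)) (by fun_prop) fun r hr ↦ ⟨hs, hr⟩
  exact h.aemeasurable measurableSet_Ioi

theorem IsAdditiveSubordinator.integrableOn_exp_sub_one
    (hZ : IsAdditiveSubordinator P Z β g) {s : ℝ} (hs : 0 ≤ s) {z : ℂ} (hz : z.re ≤ 0) :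
    IntegrableOn (fun r : ℝ ↦ (g s r : ℝ) • (Complex.exp (r * z) - 1)) (Ioi 0) := by
  refine Integrable.mono' ((hZ.g_integrable s hs).const_mul (‖z‖ + 2))
    ((hZ.aemeasurable_density hs).aestronglyMeasurable.smul (by fun_prop)) ?_
  refine ae_restrict_of_forall_mem measurableSet_Ioi fun r hr ↦ ?_
  have hr0 : (0 : ℝ) < r := hr
  have hg := hZ.g_nonneg s r hs hr0
  have hre : ((r : ℂ) * z).re ≤ 0 := by
    rw [Complex.re_ofReal_mul]
    exact mul_nonpos_of_nonneg_of_nonpos hr0.le hz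
  have h1 : ‖Complex.exp (r * z) - 1‖ ≤ r * ‖z‖ := by
    refine (norm_exp_sub_one_le_of_re_nonpos hre).trans_eq ?_
    rw [norm_mul, Complex.norm_real, Real.norm_of_nonneg hr0.le]
  have h2 : ‖Complex.exp (r * z) - 1‖ ≤ 2 := by
    refine (norm_sub_le _ _).trans ?_
    rw [Complex.norm_exp, norm_one]
    linarith [Real.exp_le_one_iff.2 hre]
  have h3 : ‖Complex.exp (r * z) - 1‖ ≤ (‖z‖ + 2) * min 1 r := by
    have := norm_nonneg z
    rcases le_total 1 r with h | h
    · rw [min_eq_left h]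
      linarith
    · rw [min_eq_right h]
      nlinarith
  rw [norm_smul, Real.norm_of_nonneg hg, mul_comm (min 1 r), mul_left_comm]
  exact mul_le_mul_of_nonneg_left h3 hg

variable [IsProbabilityMeasure P]

theorem IsAdditive.measurable_map_toNNReal (hX : IsAdditive P X) :
    Measurable fun r : ℝ ↦ P.map (X r.toNNReal) :=
  hX.measurable_map.comp measurable_real_toNNReal

theorem newJumpMeasure_apply (hX : IsAdditive P X) (hZ : IsAdditiveSubordinator P Z β g) {s : ℝ}
    (hs : 0 ≤ s) {A : Set (EuclideanSpace ℝ (Fin n))} (hA : MeasurableSet A) (h0 : 0 ∉ A) :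
    newJumpMeasure P X ν β g s A = ENNReal.ofReal (β s) * ν A
      + ∫⁻ r in Ioi (0 : ℝ), P {ω | X r.toNNReal ω ∈ A} * ENNReal.ofReal (g s r) := by
  have hA0 : A ∩ {0}ᶜ = A := inter_eq_left.2 fun x hx hx0 ↦ h0 (by rwa [← mem_singleton_iff.1 hx0])
  have hm : Measurable fun r : ℝ ↦ P.map (X r.toNNReal) A :=
    (Measure.measurable_coe hA).comp hX.measurable_map_toNNReal
  rw [newJumpMeasure, Measure.restrict_apply hA, hA0, Measure.add_apply, Measure.smul_apply,
    smul_eq_mul, Measure.bind_apply hA hX.measurable_map_toNNReal.aemeasurable,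
    lintegral_withDensity_eq_lintegral_mul₀ (hZ.aemeasurable_density hs).ennreal_ofReal
      hm.aemeasurable]
  congr 1
  refine lintegral_congr fun r ↦ ?_
  rw [Pi.mul_apply, mul_comm, Measure.map_apply (hX.measurable _) hA]
  rfl

/-- By Tonelli the inner integral is E[|X_r|² ∧ 1] ≤ C (1 ∧ r), which `g s` integrates. -/
theorem lintegral_min_mixture_lt_top (hX : HasLevyTriplet P X c Q ν)
    (hZ : IsAdditiveSubordinator P Z β g) {s : ℝ} (hs : 0 ≤ s) :
    ∫⁻ x, ENNReal.ofReal (min (‖x‖ ^ 2) 1)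
      ∂((volume.restrict (Ioi (0 : ℝ))).withDensity fun r ↦ ENNReal.ofReal (g s r)).bind
        (fun r ↦ P.map (X r.toNNReal)) < ∞ := by
  obtain ⟨C, hC0, hC⟩ := hX.exists_truncated_moments_le
  have hF : Measurable fun x : EuclideanSpace ℝ (Fin n) ↦ ENNReal.ofReal (min (‖x‖ ^ 2) 1) := by
    fun_prop
  have hκ := hX.levy.toIsAdditive.measurable_map_toNNReal
  have hFκ : Measurable fun r : ℝ ↦
      ∫⁻ x, ENNReal.ofReal (min (‖x‖ ^ 2) 1) ∂(P.map (X r.toNNReal)) :=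
    (Measure.measurable_lintegral hF).comp hκ
  rw [Measure.lintegral_bind hκ.aemeasurable hF.aemeasurable,
    lintegral_withDensity_eq_lintegral_mul₀ (hZ.aemeasurable_density hs).ennreal_ofReal
      hFκ.aemeasurable]
  refine lt_of_le_of_lt ?_ ((hZ.g_integrable s hs).const_mul C).lintegral_lt_top
  refine setLIntegral_mono_ae' measurableSet_Ioi (.of_forall fun r hr ↦ ?_)
  have hr0 : (0 : ℝ) < r := hr
  have hXm := hX.levy.measurable r.toNNReal
  have hle : ∫⁻ x, ENNReal.ofReal (min (‖x‖ ^ 2) 1) ∂(P.map (X r.toNNReal))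
      ≤ ENNReal.ofReal (C * min 1 r) := by
    rw [lintegral_map hF hXm, ← ofReal_integral_eq_lintegral_ofReal (integrable_min_norm_sq hXm)
      (.of_forall fun ω ↦ by positivity)]
    refine ENNReal.ofReal_le_ofReal ?_
    simpa [hr0.le] using (hC r.toNNReal).1
  calc _ ≤ ENNReal.ofReal (g s r) * ENNReal.ofReal (C * min 1 r) := mul_le_mul_right hle _
    _ = ENNReal.ofReal (C * (min 1 r * g s r)) := by
      rw [← ENNReal.ofReal_mul (hZ.g_nonneg s r hs hr0)]
      congr 1
      ring

theorem isLevyMeasure_newJumpMeasure (hX : HasLevyTriplet P X c Q ν)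
    (hZ : IsAdditiveSubordinator P Z β g) {s : ℝ} (hs : 0 ≤ s) :
    IsLevyMeasure (newJumpMeasure P X ν β g s) := by
  refine ⟨?_, ?_⟩
  · rw [newJumpMeasure, Measure.restrict_apply (measurableSet_singleton 0)]
    simp
  · refine (lintegral_mono' Measure.restrict_le_self le_rfl).trans_lt ?_
    rw [lintegral_add_measure, lintegral_smul_measure]
    exact ENNReal.add_lt_top.2 ⟨ENNReal.mul_lt_top ENNReal.ofReal_lt_top hX.levyMeasure.2,
      lintegral_min_mixture_lt_top hX hZ hs⟩

theorem stronglyMeasurable_truncatedMean (hX : IsAdditive P X) :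
    StronglyMeasurable (truncatedMean P X) := by
  have h : Measurable fun p : ℝ × Ω ↦
      (Metric.closedBall (0 : EuclideanSpace ℝ (Fin n)) 1).indicator id (X p.1.toNNReal p.2) :=
    measurable_indicator_closedBall.comp (hX.measurable_uncurry.comp
      ((measurable_real_toNNReal.comp measurable_fst).prodMk measurable_snd))
  exact h.stronglyMeasurable.integral_prod_right'

theorem integrableOn_smul_truncatedMean (hX : HasLevyTriplet P X c Q ν)
    (hZ : IsAdditiveSubordinator P Z β g) {s : ℝ} (hs : 0 ≤ s) :
    IntegrableOn (fun r ↦ g s r • truncatedMean P X r) (Ioi 0) := by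
  obtain ⟨C, hC0, hC⟩ := hX.exists_truncated_moments_le
  refine Integrable.mono' ((hZ.g_integrable s hs).const_mul C)
    ((hZ.aemeasurable_density hs).aestronglyMeasurable.smul
      (stronglyMeasurable_truncatedMean hX.levy.toIsAdditive).aestronglyMeasurable) ?_
  refine ae_restrict_of_forall_mem measurableSet_Ioi fun r hr ↦ ?_
  have hr0 : (0 : ℝ) < r := hr
  have hg := hZ.g_nonneg s r hs hr0
  have h := (hC r.toNNReal).2
  rw [Real.coe_toNNReal r hr0.le] at h
  rw [norm_smul, Real.norm_of_nonneg hg, mul_comm (min 1 r), mul_left_comm]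
  exact mul_le_mul_of_nonneg_left h hg

/-- The law of X_r is finite, so the compensator can be integrated separately; it produces the
truncated mean that the new drift absorbs. -/
theorem integral_levyIntegrand_map (hX : HasLevyTriplet P X c Q ν) (u : EuclideanSpace ℝ (Fin n))
    {r : ℝ} (hr : 0 ≤ r) :
    ∫ x, levyIntegrand u x ∂(P.map (X r.toNNReal))
      = (Complex.exp (r * levyKhintchine c Q ν u) - 1)
        - Complex.I * (inner ℝ u (truncatedMean P X r) : ℝ) := by
  have hXm := hX.levy.measurable r.toNNReal
  have hi := integrable_indicator_closedBall (P := P) hXm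
  have hu : Measurable fun ω ↦ inner ℝ u (X r.toNNReal ω) := by fun_prop
  have he := integrable_exp_I_mul (P := P) hu
  have hI (x : EuclideanSpace ℝ (Fin n)) : levyIntegrand u x
      = (Complex.exp (Complex.I * (inner ℝ u x : ℝ)) - 1)
        - Complex.I * ((inner ℝ u ((Metric.closedBall 0 1).indicator id x) : ℝ) : ℂ) := by
    rw [levyIntegrand]
    by_cases hx : x ∈ Metric.closedBall (0 : EuclideanSpace ℝ (Fin n)) 1
    · simp [indicator_of_mem hx]
    · simp [indicator_of_notMem hx]
  have hcf := hX.charFun_eq r.toNNReal u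
  rw [Real.coe_toNNReal r hr] at hcf
  have hinner : ∫ ω, (inner ℝ u ((Metric.closedBall 0 1).indicator id (X r.toNNReal ω)) : ℝ) ∂P
      = inner ℝ u (truncatedMean P X r) := integral_inner hi u
  rw [integral_map hXm.aemeasurable (measurable_levyIntegrand u).aestronglyMeasurable]
  simp_rw [hI]
  have he1 : Integrable (fun ω ↦
      Complex.exp (Complex.I * (inner ℝ u (X r.toNNReal ω) : ℝ)) - 1) P :=
    he.sub (integrable_const _)
  have hi1 : Integrable (fun ω ↦ Complex.I *
      ((inner ℝ u ((Metric.closedBall 0 1).indicator id (X r.toNNReal ω)) : ℝ) : ℂ)) P :=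
    (hi.const_inner u).ofReal.const_mul _
  rw [integral_sub he1 hi1, integral_sub he (integrable_const _), integral_const_mul, hcf,
    integral_complex_ofReal, hinner]
  simp

/-- The exponent of the time-changed process is the Laplace exponent of the time change evaluated
at the exponent of the Lévy process. -/
theorem levyKhintchine_timeChange (hX : HasLevyTriplet P X c Q ν)
    (hZ : IsAdditiveSubordinator P Z β g) {s : ℝ} (hs : 0 ≤ s) (u : EuclideanSpace ℝ (Fin n)) :
    levyKhintchine (newDrift P X c β g s) (β s • Q) (newJumpMeasure P X ν β g s) u
      = laplaceRate β g s (-levyKhintchine c Q ν u) := by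
  have hκ := hX.levy.toIsAdditive.measurable_map_toNNReal
  have hmix := integrable_levyIntegrand_of_lintegral_lt_top
    (lintegral_min_mixture_lt_top hX hZ hs) u
  have hν := integrable_levyIntegrand_of_lintegral_lt_top hX.levyMeasure.2 u
  have hdrift := integrableOn_smul_truncatedMean hX hZ hs
  have hexp := hZ.integrableOn_exp_sub_one hs (hX.re_levyKhintchine_nonpos u)
  have hβ := hZ.β_nonneg s hs
  have hinner : IntegrableOn (fun r ↦ Complex.I *
      ((inner ℝ u (g s r • truncatedMean P X r) : ℝ) : ℂ)) (Ioi 0) :=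
    (hdrift.const_inner u).ofReal.const_mul _
  have hmixture : ∫ x, levyIntegrand u x
      ∂((volume.restrict (Ioi (0 : ℝ))).withDensity fun r ↦ ENNReal.ofReal (g s r)).bind
        (fun r ↦ P.map (X r.toNNReal))
      = (∫ r in Ioi (0 : ℝ), (g s r : ℝ) • (Complex.exp (r * levyKhintchine c Q ν u) - 1))
        - Complex.I * ((inner ℝ u (∫ r in Ioi (0 : ℝ), g s r • truncatedMean P X r) : ℝ) : ℂ) := by
    rw [integral_bind hκ hmix, integral_withDensity_eq_integral_toReal_smul₀
      (hZ.aemeasurable_density hs).ennreal_ofReal (.of_forall fun r ↦ ENNReal.ofReal_lt_top),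
      ← integral_inner hdrift u, ← integral_complex_ofReal, ← integral_const_mul,
      ← integral_sub hexp hinner]
    refine setIntegral_congr_fun measurableSet_Ioi fun r hr ↦ ?_
    have hr0 : (0 : ℝ) < r := hr
    rw [integral_levyIntegrand_map hX u hr0.le, ENNReal.toReal_ofReal (hZ.g_nonneg s r hs hr0),
      inner_smul_right, smul_sub]
    simp only [Complex.real_smul]
    push_cast
    ring
  have hjump : ∫ x, levyIntegrand u x ∂(newJumpMeasure P X ν β g s)
      = β s * ∫ x, levyIntegrand u x ∂ν
        + ∫ x, levyIntegrand u x
          ∂((volume.restrict (Ioi (0 : ℝ))).withDensity fun r ↦ ENNReal.ofReal (g s r)).bind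
            (fun r ↦ P.map (X r.toNNReal)) := by
    -- The integrand vanishes at 0, so a possible atom there is harmless.
    rw [newJumpMeasure, setIntegral_eq_integral_of_forall_compl_eq_zero,
      integral_add_measure (hν.smul_measure ENNReal.ofReal_ne_top) hmix, integral_smul_measure,
      ENNReal.toReal_ofReal hβ, Complex.real_smul]
    intro x hx
    rw [notMem_compl_iff, mem_singleton_iff] at hx
    rw [hx, levyIntegrand_zero]
  have hlaplace : ∫ r in Ioi (0 : ℝ),
      (Complex.exp (-(-levyKhintchine c Q ν u) * (r : ℂ)) - 1) * (g s r : ℂ)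
      = ∫ r in Ioi (0 : ℝ), (g s r : ℝ) • (Complex.exp (r * levyKhintchine c Q ν u) - 1) := by
    refine integral_congr_ae (.of_forall fun r ↦ ?_)
    simp only [neg_neg, Complex.real_smul]
    rw [mul_comm (levyKhintchine c Q ν u), mul_comm]
  rw [laplaceRate, hlaplace, levyKhintchine, hjump, hmixture, newDrift, inner_add_right,
    inner_smul_right, Matrix.smul_mulVec, dotProduct_smul, smul_eq_mul]
  -- Naming the integral shields the exponent inside it from the next unfolding; the truncated means
  -- then cancel algebraically.
  generalize (∫ r in Ioi (0 : ℝ), (g s r : ℝ) •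
    (Complex.exp (r * levyKhintchine c Q ν u) - 1)) = J
  rw [levyKhintchine]
  push_cast
  ring

theorem integral_exp_timeChange (hX : HasLevyTriplet P X c Q ν)
    (hZ : IsAdditiveSubordinator P Z β g)
    (hXZ : IndepFun (fun ω t ↦ X t ω) (fun ω t ↦ Z t ω) P)
    (u : EuclideanSpace ℝ (Fin n)) (t : ℝ≥0) :
    ∫ ω, Complex.exp (Complex.I * (inner ℝ u (timeChange X Z t ω) : ℝ)) ∂P
      = ∫ ω, Complex.exp (-(-levyKhintchine c Q ν u) * ((Z t ω : ℝ) : ℂ)) ∂P := by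
  have hY := hX.levy.toIsAdditive.measurable_timeChange (hZ.measurable t)
  have hmap := map_timeChange hX.levy hZ.measurable hZ.monotone hZ.zero hXZ t
  have hF : Measurable fun x : EuclideanSpace ℝ (Fin n) ↦
      Complex.exp (Complex.I * ((inner ℝ u x : ℝ) : ℂ)) := by fun_prop
  have := Measure.isProbabilityMeasure_map (μ := P) hY.aemeasurable
  have hint : Integrable (fun x : EuclideanSpace ℝ (Fin n) ↦
      Complex.exp (Complex.I * ((inner ℝ u x : ℝ) : ℂ))) (P.map (timeChange X Z t)) :=
    integrable_exp_I_mul (by fun_prop)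
  rw [← integral_map hY.aemeasurable hF.aestronglyMeasurable
    (f := fun x ↦ Complex.exp (Complex.I * ((inner ℝ u x : ℝ) : ℂ)))]
  rw [hmap] at hint ⊢
  rw [integral_bind hX.levy.toIsAdditive.measurable_map hint]
  have hr (r : ℝ≥0) : ∫ x, Complex.exp (Complex.I * ((inner ℝ u x : ℝ) : ℂ)) ∂(P.map (X r))
      = Complex.exp (-(-levyKhintchine c Q ν u) * ((r : ℝ) : ℂ)) := by
    rw [integral_map (hX.levy.measurable r).aemeasurable hF.aestronglyMeasurable, hX.charFun_eq,
      neg_neg, mul_comm]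
  simp_rw [hr]
  rw [integral_map (hZ.measurable t).aemeasurable (by fun_prop)]

theorem hasCharacteristics_timeChange (hX : HasLevyTriplet P X c Q ν)
    (hZ : IsAdditiveSubordinator P Z β g)
    (hXZ : IndepFun (fun ω t ↦ X t ω) (fun ω t ↦ Z t ω) P) :
    HasCharacteristics P (timeChange X Z) (newDrift P X c β g) (fun s ↦ β s • Q)
      (newJumpMeasure P X ν β g) := by
  have hre (u : EuclideanSpace ℝ (Fin n)) : 0 ≤ (-levyKhintchine c Q ν u).re := by
    simpa using hX.re_levyKhintchine_nonpos u
  have heq (u : EuclideanSpace ℝ (Fin n)) (t : ℝ≥0) : ∀ s ∈ uIcc (0 : ℝ) t,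
      levyKhintchine (newDrift P X c β g s) (β s • Q) (newJumpMeasure P X ν β g s) u
        = laplaceRate β g s (-levyKhintchine c Q ν u) := fun s hs ↦ by
    rw [uIcc_of_le t.coe_nonneg] at hs
    exact levyKhintchine_timeChange hX hZ hs.1 u
  refine ⟨fun s hs ↦ hX.posSemidef.smul (hZ.β_nonneg s hs),
    fun s hs ↦ isLevyMeasure_newJumpMeasure hX hZ hs,
    fun s hs u ↦ integrable_levyIntegrand_of_lintegral_lt_top
      (isLevyMeasure_newJumpMeasure hX hZ hs).2 u, fun u t ↦ ?_, fun u t ↦ ?_⟩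
  · exact (hZ.rate_integrable _ (hre u) t).congr
      fun s hs ↦ (heq u t s (uIoc_subset_uIcc hs)).symm
  · rw [integral_exp_timeChange hX hZ hXZ, hZ.laplace_eq _ (hre u),
      intervalIntegral.integral_congr (heq u t)]

end Mixture

end AdditiveTimeChange

theorem mainTheorem2 {Ω : Type*} [MeasurableSpace Ω] (P : Measure Ω) [IsProbabilityMeasure P]
    {n : ℕ} (X : ℝ≥0 → Ω → EuclideanSpace ℝ (Fin n)) (c : EuclideanSpace ℝ (Fin n))
    (Q : Matrix (Fin n) (Fin n) ℝ) (ν : Measure (EuclideanSpace ℝ (Fin n)))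
    (hX : HasLevyTriplet P X c Q ν)
    (Z : ℝ≥0 → Ω → ℝ≥0) (β : ℝ → ℝ) (g : ℝ → ℝ → ℝ)
    (hZ : IsAdditiveSubordinator P Z β g)
    (hXZ : IndepFun (fun ω t ↦ X t ω) (fun ω t ↦ Z t ω) P) :
    -- `Y` is an additive process with càdlàg paths; it is also continuous in probability
    IsAdditive P (timeChange X Z) ∧
    (∀ t, TendstoInMeasure P (timeChange X Z) (𝓝 t) (timeChange X Z t)) ∧
    -- the integral in the drift converges
    (∀ s, 0 ≤ s → IntegrableOn (fun r ↦ g s r • truncatedMean P X r) (Ioi 0)) ∧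
    -- the jump measure is given on Borel sets of `ℝⁿ ∖ {0}` by the stated formula
    (∀ s, 0 ≤ s → ∀ A, MeasurableSet A → 0 ∉ A →
      newJumpMeasure P X ν β g s A = ENNReal.ofReal (β s) * ν A
        + ∫⁻ r in Ioi (0 : ℝ), P {ω | X r.toNNReal ω ∈ A} * ENNReal.ofReal (g s r)) ∧
    -- the characteristics of `Y`
    HasCharacteristics P (timeChange X Z) (newDrift P X c β g) (fun s ↦ β s • Q)
      (newJumpMeasure P X ν β g) :=
  ⟨isAdditive_timeChange hX.levy hZ hXZ, tendstoInMeasure_timeChange hX.levy hZ hXZ,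
    fun _ hs ↦ integrableOn_smul_truncatedMean hX hZ hs,
    fun _ hs _ hA h0 ↦ newJumpMeasure_apply hX.levy.toIsAdditive hZ hs hA h0,
    hasCharacteristics_timeChange hX hZ hXZ⟩
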